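/- **Theorem 1 (The central limit theorem).** Let $(\xi_n)_{n\ge 1}$ be a sequence of independent real random variables on a common probability space with finite second moments. Let $F_n$ be the distribution function of $\xi_n$ and put $m_n = E\xi_n$, $\sigma_n^2 = \operatorname{Var}\xi_n$, $S_n = \xi_1+\dots+\xi_n$ and $B_n^2 = \operatorname{Var} S_n = \sigma_1^2+\dots+\sigma_n^2$ with $B_n\ge 0$. For $s\ge 0$ let $$\alpha_n(s) = \frac{1}{\sigma_n^2}\int_{|x-m_n|\ge s} |x-m_n|^2\, dF_n(x) \quad\text{if } \sigma_n>0, \qquad \alpha_n(s)=0 \quad\text{if } \sigma_n=0.$$ Assume that 1. the sequence is non-singular, that is, at least one $\xi_n$ has a distribution that is neither degenerate (concentrated at one point) nor normal; 2. the uniform convergence condition holds: $\sup_{n} \alpha_n(s)\to 0$ as $s\to\infty$. Then the normalized sums $(S_n - ES_n)/B_n$ (defined for all sufficiently large $n$, since $B_n>0$ eventually by 1.) converge in distribution to the standard normal law $N(0,1)$ as $n\to\infty$ if and only if $B_n^2\to\infty$ as $n\to\infty$. -/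

import Mathlib

open MeasureTheory ProbabilityTheory Filter Topology

noncomputable section

namespace ShmyrovCLT

variable {Ω : Type*} [MeasurableSpace Ω]

/-- The law of `X` is concentrated at a single point. -/
def IsDegenerate (P : Measure Ω) (X : Ω → ℝ) : Prop :=
  ∃ c : ℝ, P.map X = Measure.dirac c

/-- The law of `X` is a normal distribution with positive variance. -/
def IsNormal (P : Measure Ω) (X : Ω → ℝ) : Prop :=
  ∃ (m : ℝ) (v : NNReal), v ≠ 0 ∧ P.map X = gaussianReal m v

/-- Every member of the sequence is degenerate or normal. -/
def IsSingular (P : Measure Ω) (ξ : ℕ → Ω → ℝ) : Prop :=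
  ∀ n, IsDegenerate P (ξ n) ∨ IsNormal P (ξ n)

open Classical in
/-- The normalized tail of the variance integral of `X`: with `m = E X`, `σ² = Var X`,
it is `σ⁻² ∫_{|x - m| ≥ s} |x - m|² dF(x)` if `σ² ≠ 0`, and `0` otherwise. -/
def varianceTail (P : Measure Ω) (X : Ω → ℝ) (s : ℝ) : ℝ :=
  if Var[X; P] = 0 then 0
  else (1 / Var[X; P]) * ∫ x in {x : ℝ | s ≤ |x - P[X]|}, |x - P[X]| ^ 2 ∂(P.map X)

/-- `sup_n α_n(s) → 0` as `s → ∞`. For square integrable variables every `α_n(s)` lies in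
`[0, 1]`, so the real supremum is the true one. -/
def UniformConvergenceCondition (P : Measure Ω) (ξ : ℕ → Ω → ℝ) : Prop :=
  Tendsto (fun s : ℝ => ⨆ n, varianceTail P (ξ n) s) atTop (𝓝 0)

/-- The sum of the first `n` members of the sequence; the members are `ξ 0, ξ 1, …`. -/
def partialSum (ξ : ℕ → Ω → ℝ) (n : ℕ) (ω : Ω) : ℝ :=
  ∑ k ∈ Finset.range n, ξ k ω

/-- The total variance `B_n² = Var S_n`. -/
def totalVariance (P : Measure Ω) (ξ : ℕ → Ω → ℝ) (n : ℕ) : ℝ :=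
  Var[partialSum ξ n; P]

/-- The normalized sum `(S_n - E S_n) / B_n`. -/
def normalizedSum (P : Measure Ω) (ξ : ℕ → Ω → ℝ) (n : ℕ) (ω : Ω) : ℝ :=
  (partialSum ξ n ω - P[partialSum ξ n]) / √(totalVariance P ξ n)

end ShmyrovCLT

end

/-! Necessity: `B_n²` is nondecreasing, so if it does not diverge it has a finite limit `L`,
positive by non-singularity. The characteristic function of `ξ_k / √L` then divides that of
`N(0,1)`; the quotient is a continuous limit of characteristic functions, hence itself one by Lévy's
theorem. So `ξ_k / √L` is a convolution factor of `N(0,1)`, and Cramér's theorem makes every `ξ_k`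
degenerate or normal, a contradiction.

Sufficiency: the characteristic function of the normalized sum and `exp(-t²/2)` are both products
over `k < n`, and their difference is at most the sum of the differences of the factors
(`Finset.norm_prod_sub_prod_le`). By `norm_charFun_sub_exp_le` each difference is at most `σ_k²`
times a quantity free of `k`, and the weights `σ_k² / B_n²` sum to 1. The uniform tail condition
makes that common quantity small once `B_n → ∞`. -/

/-! ### Zero-free entire functions and quadratic growth -/

lemma Complex.exists_exp_eq_of_entire {f : ℂ → ℂ} (hf : Differentiable ℂ f)
    (hne : ∀ z, f z ≠ 0) (h0 : f 0 = 1) :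
    ∃ g : ℂ → ℂ, Differentiable ℂ g ∧ g 0 = 0 ∧ ∀ z, f z = Complex.exp (g z) := by
  -- A primitive of the logarithmic derivative is a logarithm of `f`: the product `f * exp (-g)` has
  -- zero derivative.
  have hd : Differentiable ℂ fun z => deriv f z / f z := by
    have : Differentiable ℂ (deriv f) := hf.contDiff.differentiable_deriv_two
    exact this.div hf hne
  obtain ⟨g, hg0, hg⟩ := hd.isExactOn_univ.with_val_at 0 0
  have hg' : ∀ z, HasDerivAt g (deriv f z / f z) z := fun z => hg z (Set.mem_univ z)
  refine ⟨g, fun z => (hg' z).differentiableAt, hg0, fun z => ?_⟩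
  have hder : ∀ w, HasDerivAt (fun z => f z * Complex.exp (-g z)) 0 w := by
    intro w
    convert! (hf w).hasDerivAt.mul (hg' w).neg.cexp using 1
    field_simp [hne w]
    ring
  have hconst := is_const_of_deriv_eq_zero (fun w => (hder w).differentiableAt)
    (fun w => (hder w).deriv) z 0
  simp only [hg0, h0, neg_zero, Complex.exp_zero, mul_one] at hconst
  rw [Complex.exp_neg] at hconst
  field_simp at hconst
  exact hconst

/-- An entire function whose real part grows at most quadratically is a quadratic polynomial. -/
lemma Complex.eq_quadratic_of_re_le {g : ℂ → ℂ} (hg : Differentiable ℂ g) (h0 : g 0 = 0)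
    {A C : ℝ} (hA : 0 < A) (hC : 0 ≤ C) (hre : ∀ z, (g z).re ≤ A + C * ‖z‖ ^ 2) :
    ∃ a b : ℂ, ∀ z, g z = a * z + b * z ^ 2 := by
  have hbound : ∀ r : ℝ, 0 < r → ∀ z ∈ Metric.sphere (0 : ℂ) r,
      ‖g z‖ ≤ 2 * (A + C * (2 * r) ^ 2) := by
    intro r hr z hz
    have hz' : ‖z‖ = r := by simpa using hz
    have hM : 0 < A + C * (2 * r) ^ 2 := by positivity
    -- On the disc of radius `2r` the factor `2‖z‖ / (R - ‖z‖)` equals 2 at `‖z‖ = r`.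
    have := Complex.borelCaratheodory_zero (R := 2 * r) (z := z) hM hg.differentiableOn
      (fun w hw => by
        have hw' : ‖w‖ < 2 * r := by simpa using hw
        refine (hre w).trans ?_
        gcongr) (by positivity) (by simp [hz']; linarith) h0
    rw [hz'] at this
    convert! this using 1
    field_simp
    ring
  have hzero : ∀ n : ℕ, 3 ≤ n → iteratedDeriv n g 0 = 0 := by
    intro n hn
    -- Cauchy's estimate gives `O(r^(2-n))`, which is `O(1/r)` for `n ≥ 3`.
    have hle : ∀ r : ℝ, 1 ≤ r →
        ‖iteratedDeriv n g 0‖ ≤ (n.factorial * (2 * (A + 4 * C))) * r⁻¹ := by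
      intro r hr
      have hr0 : 0 < r := by linarith
      refine (Complex.norm_iteratedDeriv_le_of_forall_mem_sphere_norm_le n hr0
        hg.diffContOnCl (hbound r hr0)).trans ?_
      rw [mul_div_assoc, mul_assoc]
      gcongr
      rw [div_le_iff₀ (by positivity), mul_assoc]
      have h1 : r ^ 2 ≤ r⁻¹ * r ^ n := by
        rw [← div_eq_inv_mul, le_div_iff₀ hr0, ← pow_succ]
        exact pow_le_pow_right₀ hr hn
      have h2 : (1 : ℝ) ≤ r ^ 2 := one_le_pow₀ hr
      calc 2 * (A + C * (2 * r) ^ 2) ≤ 2 * ((A + 4 * C) * r ^ 2) := by nlinarith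
        _ ≤ 2 * ((A + 4 * C) * (r⁻¹ * r ^ n)) := by gcongr
        _ = _ := by ring
    have hlim : Tendsto (fun r : ℝ => (n.factorial * (2 * (A + 4 * C))) * r⁻¹) atTop (𝓝 0) := by
      simpa using tendsto_inv_atTop_zero.const_mul ((n.factorial : ℝ) * (2 * (A + 4 * C)))
    have := ge_of_tendsto hlim ((eventually_ge_atTop 1).mono hle)
    exact norm_le_zero_iff.1 this
  refine ⟨iteratedDeriv 1 g 0, iteratedDeriv 2 g 0 / 2, fun z => ?_⟩
  rw [← Complex.taylorSeries_eq_of_entire' 0 z hg, tsum_eq_sum (s := Finset.range 3)]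
  · simp only [Finset.sum_range_succ, Finset.sum_range_zero, iteratedDeriv_zero, h0, sub_zero,
      Nat.factorial]
    push_cast
    ring
  · intro n hn
    rw [hzero n (by simpa using hn)]
    simp

/-! ### Cramér's decomposition theorem -/

/-- Half of the mass lies in some `[-n, n]`, where `exp (t * x) ≥ exp (-n|t|)`. Bounding one
convolution factor from below turns the product identity into an upper bound on the other. -/
lemma exists_exp_neg_sub_le_mgf (ν : Measure ℝ) [IsProbabilityMeasure ν]
    (hint : ∀ t, Integrable (fun x => Real.exp (t * x)) ν) :
    ∃ C : ℝ, 0 ≤ C ∧ ∀ t, Real.exp (-1 - C * |t|) ≤ mgf id ν t := by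
  obtain ⟨n, hn⟩ : ∃ n : ℕ, 1 / 2 ≤ ν.real (Set.Icc (-n : ℝ) n) := by
    have hmono : Monotone fun n : ℕ => Set.Icc (-n : ℝ) n := fun a b hab =>
      Set.Icc_subset_Icc (by simpa using hab) (by simpa using hab)
    have hU : ⋃ n : ℕ, Set.Icc (-n : ℝ) n = Set.univ := by
      refine Set.eq_univ_of_forall fun x => ?_
      obtain ⟨n, hn⟩ := exists_nat_ge |x|
      exact Set.mem_iUnion.2 ⟨n, abs_le.1 hn⟩
    have h := tendsto_measure_iUnion_atTop (μ := ν) hmono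
    rw [hU, measure_univ] at h
    have h' := (ENNReal.tendsto_toReal ENNReal.one_ne_top).comp h
    have := h'.eventually (lt_mem_nhds (show (1 / 2 : ℝ) < (1 : ENNReal).toReal by norm_num))
    obtain ⟨n, hn⟩ := this.exists
    exact ⟨n, hn.le⟩
  refine ⟨n, by positivity, fun t => ?_⟩
  have h1 : Real.exp (-(n * |t|)) * (1 / 2) ≤ mgf id ν t := by
    calc Real.exp (-(n * |t|)) * (1 / 2)
        ≤ Real.exp (-(n * |t|)) * ν.real (Set.Icc (-n : ℝ) n) := by gcongr
      _ = ∫ x in Set.Icc (-n : ℝ) n, Real.exp (-(n * |t|)) ∂ν := by simp [mul_comm]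
      _ ≤ ∫ x in Set.Icc (-n : ℝ) n, Real.exp (t * x) ∂ν := by
        refine setIntegral_mono_on (by simp) (hint t).integrableOn measurableSet_Icc
          fun x hx => Real.exp_le_exp.2 ?_
        have h2 : |t * x| ≤ n * |t| := by
          rw [abs_mul, mul_comm]
          exact mul_le_mul_of_nonneg_right (abs_le.2 hx) (abs_nonneg t)
        exact (neg_le_neg h2).trans (neg_abs_le _)
      _ ≤ ∫ x, Real.exp (t * x) ∂ν :=
        setIntegral_le_integral (hint t) (ae_of_all _ fun x => (Real.exp_pos _).le)
      _ = mgf id ν t := rfl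
  refine le_trans ?_ h1
  rw [sub_eq_add_neg, Real.exp_add, mul_comm]
  have : Real.exp (-1) ≤ 1 / 2 := by
    rw [Real.exp_neg, inv_le_comm₀ (Real.exp_pos _) (by norm_num)]
    have := Real.add_one_le_exp 1
    norm_num at this ⊢
    exact this
  gcongr

section Cramer

variable {μ ν : Measure ℝ} [IsProbabilityMeasure μ] [IsProbabilityMeasure ν]

lemma integrable_exp_mul_left_of_conv {t : ℝ}
    (h : Integrable (fun x => Real.exp (t * x)) (μ ∗ ν)) :
    Integrable (fun x => Real.exp (t * x)) μ := by
  have h' := (integrable_map_measure (by fun_prop) (by fun_prop)).1 h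
  obtain ⟨y, hy⟩ := h'.prod_left_ae.exists
  simp only [Function.comp_def, mul_add, Real.exp_add] at hy
  exact (integrable_mul_const_iff (isUnit_iff_ne_zero.2 (Real.exp_pos _).ne') _).1 hy

lemma complexMGF_id_conv {z : ℂ} (h : Integrable (fun x => Real.exp (z.re * x)) (μ ∗ ν)) :
    complexMGF id (μ ∗ ν) z = complexMGF id μ z * complexMGF id ν z := by
  have hint : Integrable (fun x : ℝ => Complex.exp (z * x)) (μ ∗ ν) := by
    rw [← integrable_norm_iff (by fun_prop)]
    simpa [Complex.norm_exp] using h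
  simp only [complexMGF, id]
  rw [integral_conv hint, ← integral_mul_const]
  congr with x
  rw [← integral_const_mul]
  congr with y
  rw [← Complex.exp_add]
  push_cast
  ring_nf

/-- **Cramér's decomposition theorem**: a convolution factor of a Gaussian law is Gaussian. -/
theorem eq_gaussianReal_of_conv_eq_gaussianReal {m : ℝ} {v : NNReal}
    (h : μ ∗ ν = gaussianReal m v) : ∃ (m' : ℝ) (v' : NNReal), μ = gaussianReal m' v' := by
  have hg : ∀ t, Integrable (fun x => Real.exp (t * x)) (μ ∗ ν) := fun t => by
    rw [h]; exact integrable_exp_mul_gaussianReal t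
  have hμ : ∀ t, Integrable (fun x => Real.exp (t * x)) μ := fun t =>
    integrable_exp_mul_left_of_conv (hg t)
  have hν : ∀ t, Integrable (fun x => Real.exp (t * x)) ν := fun t =>
    integrable_exp_mul_left_of_conv (ν := μ) (by rw [Measure.conv_comm]; exact hg t)
  have hset : integrableExpSet id μ = Set.univ := Set.eq_univ_of_forall hμ
  have hdiff : Differentiable ℂ (complexMGF id μ) := fun z =>
    (hasDerivAt_complexMGF (by simp [hset])).differentiableAt
  have hprod : ∀ z : ℂ, complexMGF id μ z * complexMGF id ν z
      = Complex.exp (z * m + v * z ^ 2 / 2) := fun z => by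
    rw [← complexMGF_id_conv (hg z.re), h, complexMGF_id_gaussianReal]
  have hne : ∀ z, complexMGF id μ z ≠ 0 := fun z hz => by
    have := hprod z
    rw [hz, zero_mul] at this
    exact Complex.exp_ne_zero _ this.symm
  have hzero : complexMGF id μ 0 = 1 := by simp [complexMGF]
  obtain ⟨g, hgd, hg0, hgexp⟩ := Complex.exists_exp_eq_of_entire hdiff hne hzero
  obtain ⟨C, hC0, hC⟩ := exists_exp_neg_sub_le_mgf ν hν
  -- `exp (Re g)` is at most the moment generating function of `μ`, which is the Gaussian one
  -- divided by that of `ν`. Linear terms are absorbed by `|Re z| ≤ 1 + ‖z‖²`.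
  have hre : ∀ z, (g z).re ≤ (1 + C + |m|) + (C + |m| + v) * ‖z‖ ^ 2 := by
    intro z
    have hmul : mgf id μ z.re * mgf id ν z.re
        = Real.exp (z.re * m + v * z.re ^ 2 / 2) := by
      have := hprod z.re
      rw [complexMGF_ofReal, complexMGF_ofReal] at this
      exact_mod_cast this
    have h1 : Real.exp (g z).re ≤ mgf id μ z.re := by
      rw [← Complex.norm_exp, ← hgexp]
      exact norm_complexMGF_le_mgf
    have h2 : Real.exp ((g z).re + (-1 - C * |z.re|))
        ≤ Real.exp (z.re * m + v * z.re ^ 2 / 2) := by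
      rw [Real.exp_add, ← hmul]
      exact mul_le_mul h1 (hC _) (Real.exp_pos _).le mgf_nonneg
    have h3 := Real.exp_le_exp.1 h2
    have h4 : |z.re| ≤ 1 + ‖z‖ ^ 2 := by
      have := Complex.abs_re_le_norm z
      nlinarith [sq_nonneg (‖z‖ - 1), norm_nonneg z]
    have h5 : z.re * m ≤ |m| * |z.re| := by
      rw [← abs_mul, mul_comm]; exact le_abs_self _
    have h6 : z.re ^ 2 ≤ ‖z‖ ^ 2 := by
      rw [← sq_abs]; gcongr; exact Complex.abs_re_le_norm z
    have h7 : (v : ℝ) * z.re ^ 2 ≤ v * ‖z‖ ^ 2 := by gcongr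
    have h8 : 0 ≤ (v : ℝ) * z.re ^ 2 := by positivity
    have h9 : C * |z.re| ≤ C * (1 + ‖z‖ ^ 2) := by gcongr
    have h10 : |m| * |z.re| ≤ |m| * (1 + ‖z‖ ^ 2) := by gcongr
    nlinarith
  obtain ⟨a, b, hab⟩ := Complex.eq_quadratic_of_re_le hgd hg0 (by positivity) (by positivity) hre
  -- Characteristic functions are bounded by 1; adding the bounds at `t = 1` and `t = -1` cancels
  -- the linear term.
  have hb : 0 ≤ b.re := by
    have hle : ∀ t : ℝ, (g (t * Complex.I)).re ≤ 0 := fun t => by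
      have h1 : ‖charFun μ t‖ ≤ 1 := norm_charFun_le_one t
      rw [← complexMGF_id_mul_I, hgexp, Complex.norm_exp] at h1
      exact Real.exp_le_one_iff.1 h1
    have h1 := hle 1
    have h2 := hle (-1)
    simp [hab, pow_two] at h1 h2
    linarith
  refine ⟨a.re, (2 * b.re).toNNReal, ?_⟩
  -- On the real line the function is positive, so it equals its norm and only the real parts of `a`
  -- and `b` matter.
  have hmgf : mgf id μ = mgf id (gaussianReal a.re (2 * b.re).toNNReal) := by
    rw [mgf_id_gaussianReal, Real.coe_toNNReal _ (by positivity)]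
    ext t
    have h1 : ((mgf id μ t : ℝ) : ℂ) = Complex.exp (g t) := by
      rw [← complexMGF_ofReal, hgexp]
    have h2 : mgf id μ t = Real.exp (g t).re := by
      rw [← Complex.norm_exp, ← h1, Complex.norm_real, Real.norm_of_nonneg mgf_nonneg]
    rw [h2, hab]
    congr 1
    simp [pow_two]
    ring
  refine Measure.ext_of_complexMGF_id_eq (funext fun z => eqOn_complexMGF_of_mgf hmgf ?_)
  simp [hset]

end Cramer

/-! ### Lévy's continuity theorem -/

lemma MeasureTheory.ProbabilityMeasure.continuous_charFun_apply (t : ℝ) :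
    Continuous fun μ : ProbabilityMeasure ℝ => charFun (μ : Measure ℝ) t := by
  refine continuous_iff_continuousAt.2 fun μ => ?_
  have h := (ProbabilityMeasure.tendsto_iff_forall_integral_rclike_tendsto ℂ).1
    (tendsto_id (x := 𝓝 μ)) (BoundedContinuousFunction.innerProbChar t)
  simpa only [ContinuousAt, charFun_eq_integral_innerProbChar, id] using h

/-- **Lévy's continuity theorem**: a pointwise limit of characteristic functions that is continuous
at the origin is a characteristic function. -/
theorem exists_charFun_eq_of_tendsto_charFun {μ : ℕ → ProbabilityMeasure ℝ} {f : ℝ → ℂ}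
    (hf : ContinuousAt f 0)
    (h : ∀ t, Tendsto (fun n => charFun (μ n : Measure ℝ) t) atTop (𝓝 (f t))) :
    ∃ ν : ProbabilityMeasure ℝ, ∀ t, charFun (ν : Measure ℝ) t = f t := by
  have htight : IsTightMeasureSet
      {((ρ : ProbabilityMeasure ℝ) : Measure ℝ) | ρ ∈ Set.range μ} := by
    convert! isTightMeasureSet_of_tendsto_charFun hf h using 1
    ext ρ
    simp
  -- By tightness a weak cluster point exists; its characteristic function must agree with the
  -- pointwise limit.
  obtain ⟨ν, -, hν⟩ := (isCompact_closure_of_isTightMeasureSet htight).exists_mapClusterPt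
    (f := atTop) (u := μ) (tendsto_principal.2 (Eventually.of_forall fun n =>
      subset_closure (Set.mem_range_self n)))
  refine ⟨ν, fun t => ?_⟩
  have hc := hν.continuousAt_comp
    (ProbabilityMeasure.continuous_charFun_apply t).continuousAt
  exact eq_of_nhds_neBot (hc.neBot.mono (inf_le_inf_left _ (h t)))

/-! ### Necessity of divergence of the variance -/

namespace ShmyrovCLT

variable {Ω : Type*} [MeasurableSpace Ω] {P : Measure Ω} {ξ : ℕ → Ω → ℝ}

lemma totalVariance_eq_sum (hindep : iIndepFun ξ P) (hL2 : ∀ n, MemLp (ξ n) 2 P) (n : ℕ) :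
    totalVariance P ξ n = ∑ k ∈ Finset.range n, Var[ξ k; P] := by
  have : partialSum ξ n = ∑ k ∈ Finset.range n, ξ k := by
    ext ω; simp [partialSum]
  rw [totalVariance, this]
  exact IndepFun.variance_sum (fun k _ => hL2 k) fun i _ j _ hij => hindep.indepFun hij

lemma isDegenerate_of_variance_eq_zero [IsProbabilityMeasure P] {X : Ω → ℝ} (hX : MemLp X 2 P)
    (h : Var[X; P] = 0) : IsDegenerate P X := by
  refine ⟨P[X], ?_⟩
  rw [Measure.map_congr (ae_eq_integral_of_variance_eq_zero hX h)]
  simp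

lemma isDegenerate_or_isNormal_of_map_const_mul {X : Ω → ℝ} (hX : Measurable X) {c : ℝ}
    (hc : c ≠ 0) {m : ℝ} {v : NNReal} (h : P.map (fun ω => c * X ω) = gaussianReal m v) :
    IsDegenerate P X ∨ IsNormal P X := by
  have hlaw : P.map X = (gaussianReal m v).map (c⁻¹ * ·) := by
    rw [← h, Measure.map_map (by fun_prop) (by fun_prop)]
    congr 1
    ext ω
    simp [hc]
  rw [gaussianReal_map_const_mul] at hlaw
  by_cases hv : NNReal.mk (c⁻¹ ^ 2) (sq_nonneg _) * v = 0
  · rw [hv, gaussianReal_zero_var] at hlaw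
    exact Or.inl ⟨_, hlaw⟩
  · exact Or.inr ⟨_, _, hv, hlaw⟩

variable [IsProbabilityMeasure P]

lemma charFun_map_normalizedSum_eq_mul (hmeas : ∀ n, Measurable (ξ n)) (hindep : iIndepFun ξ P)
    {k n : ℕ} (hkn : k < n) (t : ℝ) :
    charFun (P.map (normalizedSum P ξ n)) t
      = charFun (P.map (ξ k)) ((√(totalVariance P ξ n))⁻¹ * t)
        * charFun (P.map fun ω => (√(totalVariance P ξ n))⁻¹ *
          (∑ j ∈ (Finset.range n).erase k, ξ j ω - P[partialSum ξ n])) t := by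
  set c := (√(totalVariance P ξ n))⁻¹
  have hY : Measurable fun ω => ∑ j ∈ (Finset.range n).erase k, ξ j ω - P[partialSum ξ n] := by
    fun_prop
  have hind : IndepFun (ξ k)
      (fun ω => ∑ j ∈ (Finset.range n).erase k, ξ j ω - P[partialSum ξ n]) P := by
    have h := (hindep.indepFun_finsetSum_of_notMem hmeas
      (s := (Finset.range n).erase k) (i := k) (by simp)).symm
    convert! h.comp (φ := id) (ψ := fun y : ℝ => y - P[partialSum ξ n]) measurable_id
      (by fun_prop) using 1
    ext ω
    simp
  have heq : normalizedSum P ξ n = fun ω =>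
      c * (ξ k ω + (∑ j ∈ (Finset.range n).erase k, ξ j ω - P[partialSum ξ n])) := by
    ext ω
    rw [normalizedSum, partialSum, ← Finset.add_sum_erase _ _ (Finset.mem_range.2 hkn)]
    simp only [c]
    ring
  rw [heq, charFun_map_mul_comp (by fun_prop), charFun_map_mul_comp (by fun_prop),
    hind.charFun_map_fun_add_eq_mul (by fun_prop) (by fun_prop), Pi.mul_apply]

theorem isDegenerate_or_isNormal_of_tendsto (hmeas : ∀ n, Measurable (ξ n))
    (hindep : iIndepFun ξ P) {L : ℝ} (hL : 0 < L)
    (hvar : Tendsto (totalVariance P ξ) atTop (𝓝 L))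
    (hlim : TendstoInDistribution (normalizedSum P ξ) atTop (id : ℝ → ℝ)
      (fun _ => P) (gaussianReal 0 1)) (k : ℕ) :
    IsDegenerate P (ξ k) ∨ IsNormal P (ξ k) := by
  have hprobX : IsProbabilityMeasure (P.map (ξ k)) :=
    Measure.isProbabilityMeasure_map (hmeas k).aemeasurable
  set c : ℝ := (√L)⁻¹ with hc_def
  have hc : c ≠ 0 := by positivity
  have hct : Tendsto (fun n => (√(totalVariance P ξ n))⁻¹) atTop (𝓝 c) :=
    (hvar.sqrt).inv₀ (by positivity)
  have hφX (t : ℝ) : Tendsto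
      (fun n => charFun (P.map (ξ k)) ((√(totalVariance P ξ n))⁻¹ * t)) atTop
      (𝓝 (charFun (P.map (ξ k)) (c * t))) :=
    (continuous_charFun.tendsto _).comp (hct.mul_const t)
  have hφ (t : ℝ) : Tendsto (fun n => charFun (P.map (normalizedSum P ξ n)) t) atTop
      (𝓝 (charFun (gaussianReal 0 1) t)) := by
    have := ProbabilityMeasure.tendsto_iff_tendsto_charFun.1 hlim.tendsto t
    simpa using this
  let ρ (n : ℕ) : ProbabilityMeasure ℝ :=
    ⟨P.map fun ω => (√(totalVariance P ξ n))⁻¹ *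
      (∑ j ∈ (Finset.range n).erase k, ξ j ω - P[partialSum ξ n]),
      Measure.isProbabilityMeasure_map (by fun_prop)⟩
  -- Only eventual: for `n ≤ k` there is no term `k` to erase.
  have hfac (t : ℝ) : ∀ᶠ n in atTop, charFun (P.map (normalizedSum P ξ n)) t
      = charFun (P.map (ξ k)) ((√(totalVariance P ξ n))⁻¹ * t)
        * charFun (ρ n : Measure ℝ) t := by
    filter_upwards [eventually_gt_atTop k] with n hn
    exact charFun_map_normalizedSum_eq_mul hmeas hindep hn t
  have hGne (t : ℝ) : charFun (gaussianReal 0 1) t ≠ 0 := by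
    rw [charFun_gaussianReal]; exact Complex.exp_ne_zero _
  -- The cofactor has norm at most 1, so the limit factor dominates the Gaussian characteristic
  -- function in norm, which never vanishes.
  have hXne (t : ℝ) : charFun (P.map (ξ k)) (c * t) ≠ 0 := by
    have hle : ‖charFun (gaussianReal 0 1) t‖ ≤ ‖charFun (P.map (ξ k)) (c * t)‖ := by
      refine le_of_tendsto_of_tendsto (hφ t).norm (hφX t).norm ?_
      filter_upwards [hfac t] with n hn
      rw [hn, norm_mul]
      exact mul_le_of_le_one_right (norm_nonneg _) (norm_charFun_le_one t)
    intro h0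
    rw [h0, norm_zero] at hle
    exact hGne t (norm_le_zero_iff.1 hle)
  have hψ (t : ℝ) : Tendsto (fun n => charFun (ρ n : Measure ℝ) t) atTop
      (𝓝 (charFun (gaussianReal 0 1) t / charFun (P.map (ξ k)) (c * t))) := by
    refine ((hφ t).div (hφX t) (hXne t)).congr' ?_
    filter_upwards [hfac t, (hφX t).eventually_ne (hXne t)] with n hn hne
    simp only [Pi.div_apply]
    rw [hn, mul_div_cancel_left₀ _ hne]
  obtain ⟨ν, hν⟩ := exists_charFun_eq_of_tendsto_charFun
    (f := fun t => charFun (gaussianReal 0 1) t / charFun (P.map (ξ k)) (c * t))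
    (Continuous.continuousAt (continuous_charFun.div
      (continuous_charFun.comp (by fun_prop)) hXne)) hψ
  have hprobcX : IsProbabilityMeasure (P.map fun ω => c * ξ k ω) :=
    Measure.isProbabilityMeasure_map (by fun_prop)
  have hconv : (P.map fun ω => c * ξ k ω) ∗ (ν : Measure ℝ) = gaussianReal 0 1 := by
    refine Measure.ext_of_charFun (funext fun t => ?_)
    rw [charFun_conv, hν, charFun_map_mul_comp (by fun_prop), mul_div_cancel₀ _ (hXne t)]
  obtain ⟨m, v, h⟩ := eq_gaussianReal_of_conv_eq_gaussianReal hconv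
  exact isDegenerate_or_isNormal_of_map_const_mul (hmeas k) hc h

theorem tendsto_totalVariance_atTop (hmeas : ∀ n, Measurable (ξ n))
    (hindep : iIndepFun ξ P) (hL2 : ∀ n, MemLp (ξ n) 2 P) (hns : ¬ IsSingular P ξ)
    (hlim : TendstoInDistribution (normalizedSum P ξ) atTop (id : ℝ → ℝ)
      (fun _ => P) (gaussianReal 0 1)) :
    Tendsto (totalVariance P ξ) atTop atTop := by
  have hmono : Monotone (totalVariance P ξ) := by
    refine monotone_nat_of_le_succ fun n => ?_
    rw [totalVariance_eq_sum hindep hL2, totalVariance_eq_sum hindep hL2, Finset.sum_range_succ]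
    exact le_add_of_nonneg_right (variance_nonneg _ _)
  obtain h | ⟨L, hL⟩ := tendsto_atTop_of_monotone hmono
  · exact h
  exfalso
  simp only [IsSingular, not_forall] at hns
  obtain ⟨k, hk⟩ := hns
  refine hk (isDegenerate_or_isNormal_of_tendsto hmeas hindep ?_ hL hlim k)
  have hvk : 0 < Var[ξ k; P] := (variance_nonneg _ _).lt_of_ne fun h =>
    hk (Or.inl (isDegenerate_of_variance_eq_zero (hL2 k) h.symm))
  refine hvk.trans_le (le_trans ?_ (hmono.ge_of_tendsto hL (k + 1)))
  rw [totalVariance_eq_sum hindep hL2]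
  exact Finset.single_le_sum (f := fun k => Var[ξ k; P]) (fun _ _ => variance_nonneg _ _) (by simp)

end ShmyrovCLT

/-! ### Estimates for products and characteristic functions -/

lemma Finset.norm_prod_sub_prod_le {ι R : Type*} [NormedCommRing R] [NormOneClass R]
    {s : Finset ι} {a b : ι → R} (ha : ∀ i ∈ s, ‖a i‖ ≤ 1) (hb : ∀ i ∈ s, ‖b i‖ ≤ 1) :
    ‖∏ i ∈ s, a i - ∏ i ∈ s, b i‖ ≤ ∑ i ∈ s, ‖a i - b i‖ := by
  classical
  induction s using Finset.induction_on with
  | empty => simp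
  | insert i s hi ih =>
    rw [Finset.prod_insert hi, Finset.prod_insert hi, Finset.sum_insert hi]
    have hs : ‖∏ j ∈ s, a j‖ ≤ 1 := (Finset.norm_prod_le _ _).trans
      (Finset.prod_le_one (fun _ _ => norm_nonneg _)
        fun j hj => ha j (Finset.mem_insert_of_mem hj))
    have ih' := ih (fun j hj => ha j (Finset.mem_insert_of_mem hj))
      fun j hj => hb j (Finset.mem_insert_of_mem hj)
    have hbi := hb i (Finset.mem_insert_self i s)
    calc ‖a i * ∏ j ∈ s, a j - b i * ∏ j ∈ s, b j‖
        = ‖(a i - b i) * ∏ j ∈ s, a j + b i * (∏ j ∈ s, a j - ∏ j ∈ s, b j)‖ := by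
          congr 1; ring
      _ ≤ ‖a i - b i‖ * ‖∏ j ∈ s, a j‖ + ‖b i‖ * ‖∏ j ∈ s, a j - ∏ j ∈ s, b j‖ :=
          (norm_add_le _ _).trans (add_le_add (norm_mul_le _ _) (norm_mul_le _ _))
      _ ≤ ‖a i - b i‖ * 1 + 1 * ∑ j ∈ s, ‖a j - b j‖ := by gcongr
      _ = _ := by ring

/-- The constant 4 covers both `e`, from the Taylor remainder when `|y| ≤ 1`, and `7/2`, from the
triangle inequality when `|y| ≥ 1`. -/
lemma Complex.norm_exp_mul_I_sub_quadratic_le (y : ℝ) :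
    ‖Complex.exp (y * Complex.I) - (1 + y * Complex.I - y ^ 2 / 2)‖ ≤ 4 * y ^ 2 ∧
    ‖Complex.exp (y * Complex.I) - (1 + y * Complex.I - y ^ 2 / 2)‖ ≤ 4 * |y| ^ 3 := by
  rw [← sq_abs y]
  obtain hy | hy := le_total |y| 1
  · have h : ‖Complex.exp (y * Complex.I) - (1 + y * Complex.I - y ^ 2 / 2)‖ ≤ 4 * |y| ^ 3 := by
      have h1 := Complex.norm_exp_sub_sum_le_norm_mul_exp (y * Complex.I) 3
      have h2 : ∑ m ∈ Finset.range 3, (y * Complex.I) ^ m / (m.factorial : ℂ)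
          = 1 + y * Complex.I - y ^ 2 / 2 := by
        simp only [Finset.sum_range_succ, Finset.sum_range_zero, Nat.factorial, mul_pow,
          Complex.I_sq]
        push_cast
        ring
      rw [h2] at h1
      refine h1.trans ?_
      simp only [norm_mul, Complex.norm_real, Complex.norm_I, mul_one, Real.norm_eq_abs]
      rw [mul_comm]
      exact mul_le_mul_of_nonneg_right ((Real.exp_le_exp.2 hy).trans
        (Real.exp_one_lt_d9.le.trans (by norm_num))) (by positivity)
    refine ⟨h.trans ?_, h⟩
    exact mul_le_mul_of_nonneg_left (pow_le_pow_of_le_one (abs_nonneg y) hy (by norm_num))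
      (by norm_num)
  · have h : ‖Complex.exp (y * Complex.I) - (1 + y * Complex.I - y ^ 2 / 2)‖ ≤ 4 * |y| ^ 2 := by
      calc ‖Complex.exp (y * Complex.I) - (1 + y * Complex.I - y ^ 2 / 2)‖
          ≤ ‖Complex.exp (y * Complex.I)‖ + (‖(1 : ℂ)‖ + ‖y * Complex.I‖ + ‖(y : ℂ) ^ 2 / 2‖) :=
            (norm_sub_le _ _).trans (add_le_add_right ((norm_sub_le _ _).trans
              (add_le_add_left (norm_add_le _ _) _)) _)
        _ = 1 + (1 + |y| + |y| ^ 2 / 2) := by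
            simp [Complex.norm_exp_ofReal_mul_I]
        _ ≤ 4 * |y| ^ 2 := by nlinarith
    refine ⟨h, h.trans ?_⟩
    exact mul_le_mul_of_nonneg_left (pow_le_pow_right₀ hy (by norm_num)) (by norm_num)

lemma Real.abs_exp_neg_sub_le_sq {x : ℝ} (hx : 0 ≤ x) : |Real.exp (-x) - (1 - x)| ≤ x ^ 2 := by
  have h1 := Real.add_one_le_exp (-x)
  rw [abs_of_nonneg (by linarith)]
  obtain h | h := le_total x 1
  · have := Real.abs_exp_sub_one_sub_id_le (x := -x) (by rwa [abs_neg, abs_of_nonneg hx])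
    have := (le_abs_self _).trans this
    linarith [neg_sq x]
  · have := Real.exp_le_one_iff.2 (neg_nonpos.2 hx)
    nlinarith

section

variable {Ω : Type*} [MeasurableSpace Ω] {P : Measure Ω} [IsProbabilityMeasure P] {Z : Ω → ℝ}

/-- Lindeberg's truncation: the cubic remainder bound is used where `|Z| < u`, the quadratic one
where `|Z| ≥ u`. -/
lemma norm_charFun_sub_quadratic_le (hZ : Measurable Z) (hZ2 : MemLp Z 2 P) (h0 : P[Z] = 0)
    (y : ℝ) {u : ℝ} (hu : 0 ≤ u) :
    ‖charFun (P.map Z) y - (1 - ((∫ ω, Z ω ^ 2 ∂P : ℝ) : ℂ) * y ^ 2 / 2)‖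
      ≤ 4 * |y| ^ 3 * u * (∫ ω, Z ω ^ 2 ∂P)
        + 4 * y ^ 2 * ∫ ω in {ω | u ≤ |Z ω|}, Z ω ^ 2 ∂P := by
  have hint1 : Integrable Z P := hZ2.integrable (by norm_num)
  have hint2 : Integrable (fun ω => Z ω ^ 2) P := hZ2.integrable_sq
  have hset : MeasurableSet {ω | u ≤ |Z ω|} := measurableSet_le measurable_const (by fun_prop)
  have hq1 : Integrable (fun ω => ((y * Z ω : ℝ) : ℂ) * Complex.I) P :=
    ((hint1.const_mul y).ofReal).mul_const _
  have hq2 : Integrable (fun ω => ((y * Z ω : ℝ) : ℂ) ^ 2 / 2) P := by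
    have : Integrable (fun ω => ((y ^ 2 / 2 * Z ω ^ 2 : ℝ) : ℂ)) P :=
      (hint2.const_mul (y ^ 2 / 2)).ofReal
    refine this.congr (ae_of_all _ fun ω => ?_)
    push_cast
    ring
  have he : Integrable (fun ω => Complex.exp ((y * Z ω : ℝ) * Complex.I)) P := by
    refine Integrable.of_bound (by fun_prop) 1 (ae_of_all _ fun ω => ?_)
    rw [Complex.norm_exp_ofReal_mul_I]
  have hq : Integrable (fun ω => 1 + ((y * Z ω : ℝ) : ℂ) * Complex.I) P :=
    (integrable_const _).add hq1
  have hq' : Integrable (fun ω => 1 + ((y * Z ω : ℝ) : ℂ) * Complex.I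
      - ((y * Z ω : ℝ) : ℂ) ^ 2 / 2) P := hq.sub hq2
  have hquad : ∫ ω, (1 + ((y * Z ω : ℝ) : ℂ) * Complex.I - ((y * Z ω : ℝ) : ℂ) ^ 2 / 2) ∂P
      = 1 - ((∫ ω, Z ω ^ 2 ∂P : ℝ) : ℂ) * y ^ 2 / 2 := by
    rw [integral_sub hq hq2, integral_add (integrable_const _) hq1]
    have e1 : ∫ ω, ((y * Z ω : ℝ) : ℂ) * Complex.I ∂P = 0 := by
      rw [integral_mul_const, integral_complex_ofReal, integral_const_mul, h0]
      simp
    have e2 : ∫ ω, ((y * Z ω : ℝ) : ℂ) ^ 2 / 2 ∂P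
        = ((∫ ω, Z ω ^ 2 ∂P : ℝ) : ℂ) * y ^ 2 / 2 := by
      have : ∀ ω, ((y * Z ω : ℝ) : ℂ) ^ 2 / 2 = ((Z ω ^ 2 * (y ^ 2 / 2) : ℝ) : ℂ) := fun ω => by
        push_cast
        ring
      simp_rw [this]
      rw [integral_complex_ofReal, integral_mul_const]
      push_cast
      ring
    rw [e1, e2]
    simp
  have hchar : charFun (P.map Z) y = ∫ ω, Complex.exp ((y * Z ω : ℝ) * Complex.I) ∂P := by
    rw [charFun_apply_real, integral_map hZ.aemeasurable (by fun_prop)]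
    simp
  rw [hchar, ← hquad, ← integral_sub he hq',
    ← integral_indicator hset, ← integral_const_mul, ← integral_const_mul,
    ← integral_add (hint2.const_mul _) ((hint2.indicator hset).const_mul _)]
  refine norm_integral_le_of_norm_le ((hint2.const_mul _).add
    ((hint2.indicator hset).const_mul _)) (ae_of_all _ fun ω => ?_)
  obtain ⟨hA, hB⟩ := Complex.norm_exp_mul_I_sub_quadratic_le (y * Z ω)
  by_cases hω : ω ∈ {ω | u ≤ |Z ω|}
  · rw [Set.indicator_of_mem hω]
    have : 0 ≤ 4 * |y| ^ 3 * u * Z ω ^ 2 := by positivity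
    refine hA.trans ?_
    rw [mul_pow]
    linarith
  · rw [Set.indicator_of_notMem hω, mul_zero, add_zero]
    refine hB.trans ?_
    have hlt : |Z ω| ≤ u := (not_le.1 hω).le
    rw [abs_mul, mul_pow, pow_succ |Z ω|, sq_abs]
    have : |y| ^ 3 * (Z ω ^ 2 * |Z ω|) ≤ |y| ^ 3 * (Z ω ^ 2 * u) := by gcongr
    linarith

lemma integral_sq_le_add_setIntegral (hZ : Measurable Z) (hZ2 : MemLp Z 2 P) {u : ℝ} :
    ∫ ω, Z ω ^ 2 ∂P ≤ u ^ 2 + ∫ ω in {ω | u ≤ |Z ω|}, Z ω ^ 2 ∂P := by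
  have hint2 : Integrable (fun ω => Z ω ^ 2) P := hZ2.integrable_sq
  have hset : MeasurableSet {ω | u ≤ |Z ω|} := measurableSet_le measurable_const (by fun_prop)
  have hconst : u ^ 2 = ∫ _, u ^ 2 ∂P := by simp
  rw [← integral_indicator hset, hconst,
    ← integral_add (integrable_const _) (hint2.indicator hset)]
  refine integral_mono hint2 ((integrable_const _).add (hint2.indicator hset)) fun ω => ?_
  by_cases hω : ω ∈ {ω | u ≤ |Z ω|}
  · simp only [Set.indicator_of_mem hω]
    nlinarith [sq_nonneg u]
  · simp only [Set.indicator_of_notMem hω, add_zero]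
    exact sq_le_sq' (abs_le.1 (not_le.1 hω).le).1 (abs_le.1 (not_le.1 hω).le).2

end

/-! ### Sufficiency of divergence of the variance -/

namespace ShmyrovCLT

variable {Ω : Type*} [MeasurableSpace Ω] {P : Measure Ω} {X : Ω → ℝ} {ξ : ℕ → Ω → ℝ}

lemma integral_sub_mean_sq (hX : Measurable X) :
    ∫ ω, (X ω - P[X]) ^ 2 ∂P = Var[X; P] :=
  (variance_eq_integral hX.aemeasurable).symm

variable [IsProbabilityMeasure P]

/-- Without the denominator the identity survives zero variance, so later estimates need no case
split. -/
lemma variance_mul_varianceTail (hX : Measurable X) (hX2 : MemLp X 2 P) (u : ℝ) :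
    Var[X; P] * varianceTail P X u
      = ∫ ω in {ω | u ≤ |X ω - P[X]|}, (X ω - P[X]) ^ 2 ∂P := by
  have hint : Integrable (fun ω => (X ω - P[X]) ^ 2) P :=
    (hX2.sub (memLp_const _)).integrable_sq
  rw [varianceTail]
  split_ifs with h
  · rw [mul_zero]
    refine le_antisymm (integral_nonneg fun ω => sq_nonneg _) ?_
    rw [← h, ← integral_sub_mean_sq hX]
    exact setIntegral_le_integral hint (ae_of_all _ fun ω => sq_nonneg _)
  · rw [← mul_assoc, mul_one_div_cancel h, one_mul,
      setIntegral_map (measurableSet_le measurable_const (by fun_prop)) (by fun_prop)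
        hX.aemeasurable]
    simp only [sq_abs]
    rfl

lemma varianceTail_le_one (hX : Measurable X) (hX2 : MemLp X 2 P) (u : ℝ) :
    varianceTail P X u ≤ 1 := by
  by_cases h : Var[X; P] = 0
  · simp [varianceTail, h]
  have hpos : 0 < Var[X; P] := (variance_nonneg _ _).lt_of_ne (Ne.symm h)
  refine le_of_mul_le_mul_left ?_ hpos
  rw [variance_mul_varianceTail hX hX2, mul_one, ← integral_sub_mean_sq hX]
  exact setIntegral_le_integral (hX2.sub (memLp_const _)).integrable_sq
    (ae_of_all _ fun ω => sq_nonneg _)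

lemma varianceTail_le_iSup (hmeas : ∀ n, Measurable (ξ n)) (hL2 : ∀ n, MemLp (ξ n) 2 P)
    (k : ℕ) (u : ℝ) : varianceTail P (ξ k) u ≤ ⨆ n, varianceTail P (ξ n) u := by
  refine le_ciSup (f := fun n => varianceTail P (ξ n) u) ⟨1, ?_⟩ k
  rintro _ ⟨n, rfl⟩
  exact varianceTail_le_one (hmeas n) (hL2 n) u

/-- If all normalized tails at `u` are at most `1/2`, then `σ² ≤ u² + σ²/2`. -/
lemma exists_variance_le (hmeas : ∀ n, Measurable (ξ n)) (hL2 : ∀ n, MemLp (ξ n) 2 P)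
    (hunif : UniformConvergenceCondition P ξ) : ∃ K : ℝ, 0 ≤ K ∧ ∀ n, Var[ξ n; P] ≤ K := by
  obtain ⟨u, hu⟩ := (hunif.eventually (gt_mem_nhds (show (0 : ℝ) < 1 / 2 by norm_num))).exists
  refine ⟨2 * u ^ 2, by positivity, fun n => ?_⟩
  have h := integral_sq_le_add_setIntegral (P := P) (u := u) ((hmeas n).sub_const (P[ξ n]))
    ((hL2 n).sub (memLp_const _))
  rw [← variance_mul_varianceTail (hmeas n) (hL2 n), integral_sub_mean_sq (hmeas n)] at h
  have h2 := (varianceTail_le_iSup hmeas hL2 n u).trans hu.le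
  nlinarith [variance_nonneg (ξ n) P]

/-- The variance is kept as an overall factor so that summation over the terms produces `B_n²`. -/
lemma norm_charFun_sub_exp_le (hX : Measurable X) (hX2 : MemLp X 2 P) (y : ℝ) {u δ K : ℝ}
    (hu : 0 ≤ u) (hδ : varianceTail P X u ≤ δ) (hK : Var[X; P] ≤ K) :
    ‖charFun (P.map fun ω => X ω - P[X]) y - Complex.exp (-(Var[X; P] * y ^ 2 / 2 : ℝ))‖
      ≤ Var[X; P] * (4 * |y| ^ 3 * u + 4 * y ^ 2 * δ + K * y ^ 4 / 4) := by
  have hV := variance_nonneg X P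
  have h0 : ∫ ω, (X ω - P[X]) ∂P = 0 := by
    rw [integral_sub (hX2.integrable (by norm_num)) (integrable_const _)]
    simp
  have h1 := norm_charFun_sub_quadratic_le (P := P) (hX.sub_const (P[X]))
    (hX2.sub (memLp_const _)) h0 y hu
  rw [← variance_mul_varianceTail hX hX2, integral_sub_mean_sq hX] at h1
  have h2 : ‖(1 - ((Var[X; P] : ℝ) : ℂ) * y ^ 2 / 2)
      - Complex.exp (-(Var[X; P] * y ^ 2 / 2 : ℝ))‖ ≤ (Var[X; P] * y ^ 2 / 2) ^ 2 := by
    rw [norm_sub_rev]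
    have := Real.abs_exp_neg_sub_le_sq (x := Var[X; P] * y ^ 2 / 2) (by positivity)
    rw [← Real.norm_eq_abs, ← Complex.norm_real] at this
    convert! this using 2
    push_cast
    ring
  have h3 : 4 * y ^ 2 * (Var[X; P] * varianceTail P X u) ≤ 4 * y ^ 2 * (Var[X; P] * δ) := by
    gcongr
  have h4 : Var[X; P] * (Var[X; P] * y ^ 4 / 4) ≤ Var[X; P] * (K * y ^ 4 / 4) := by
    gcongr
  have h5 := norm_sub_le_norm_sub_add_norm_sub
    (charFun (P.map fun ω => X ω - P[X]) y) (1 - ((Var[X; P] : ℝ) : ℂ) * y ^ 2 / 2)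
    (Complex.exp (-(Var[X; P] * y ^ 2 / 2 : ℝ)))
  refine h5.trans ((add_le_add h1 h2).trans ?_)
  linarith

lemma charFun_map_normalizedSum_eq_prod (hmeas : ∀ n, Measurable (ξ n)) (hindep : iIndepFun ξ P)
    (hL2 : ∀ n, MemLp (ξ n) 2 P) (n : ℕ) (t : ℝ) :
    charFun (P.map (normalizedSum P ξ n)) t
      = ∏ k ∈ Finset.range n,
        charFun (P.map fun ω => ξ k ω - P[ξ k]) ((√(totalVariance P ξ n))⁻¹ * t) := by
  have hsum : P[partialSum ξ n] = ∑ k ∈ Finset.range n, P[ξ k] :=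
    integral_finsetSum _ fun k _ => (hL2 k).integrable (by norm_num)
  have heq : normalizedSum P ξ n = fun ω =>
      (√(totalVariance P ξ n))⁻¹ * ∑ k ∈ Finset.range n, (ξ k ω - P[ξ k]) := by
    ext ω
    rw [normalizedSum, hsum, partialSum, Finset.sum_sub_distrib, div_eq_inv_mul]
  have hind : iIndepFun (fun k ω => ξ k ω - P[ξ k]) P :=
    hindep.comp (fun k x => x - ∫ ω, ξ k ω ∂P) fun k => by fun_prop
  rw [heq, charFun_map_mul_comp (by fun_prop),
    (hind.restrict _).charFun_map_fun_finsetSum_eq_prod fun k _ => by fun_prop]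
  simp

theorem tendstoInDistribution_normalizedSum (hmeas : ∀ n, Measurable (ξ n))
    (hindep : iIndepFun ξ P) (hL2 : ∀ n, MemLp (ξ n) 2 P)
    (hunif : UniformConvergenceCondition P ξ)
    (hvar : Tendsto (totalVariance P ξ) atTop atTop) :
    TendstoInDistribution (normalizedSum P ξ) atTop (id : ℝ → ℝ)
      (fun _ => P) (gaussianReal 0 1) where
  forall_aemeasurable n := by
    unfold normalizedSum partialSum
    fun_prop
  tendsto := by
    refine ProbabilityMeasure.tendsto_iff_tendsto_charFun.2 fun t => ?_
    simp only [ProbabilityMeasure.coe_mk, Measure.map_id, charFun_gaussianReal]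
    obtain ⟨K, hK0, hK⟩ := exists_variance_le hmeas hL2 hunif
    refine tendsto_iff_norm_sub_tendsto_zero.2 (Metric.tendsto_nhds.2 fun ε hε => ?_)
    -- The truncation level `u` is fixed before `n`: `4t²δ` is the only part of the bound that
    -- survives `n → ∞`.
    have hδ : Tendsto (fun u => 4 * t ^ 2 * ⨆ n, varianceTail P (ξ n) u) atTop (𝓝 0) := by
      simpa using hunif.const_mul (4 * t ^ 2)
    obtain ⟨u, hu, hu0⟩ := ((hδ.eventually (gt_mem_nhds hε)).and (eventually_ge_atTop 0)).exists
    set δ := ⨆ n, varianceTail P (ξ n) u with hδ_def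
    have hc : Tendsto (fun n => (√(totalVariance P ξ n))⁻¹) atTop (𝓝 0) :=
      tendsto_inv_atTop_zero.comp (Real.tendsto_sqrt_atTop.comp hvar)
    have hbound : Tendsto (fun n => 4 * |t| ^ 3 * u * (√(totalVariance P ξ n))⁻¹
        + 4 * t ^ 2 * δ + K * t ^ 4 / 4 * (√(totalVariance P ξ n))⁻¹ ^ 2) atTop
        (𝓝 (4 * t ^ 2 * δ)) := by
      have := ((hc.const_mul (4 * |t| ^ 3 * u)).add_const (4 * t ^ 2 * δ)).add
        ((hc.pow 2).const_mul (K * t ^ 4 / 4))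
      simpa using this
    filter_upwards [hbound.eventually (gt_mem_nhds hu), hvar.eventually_gt_atTop 0] with n hn hpos
    rw [dist_zero_right, norm_norm]
    refine lt_of_le_of_lt ?_ hn
    rw [charFun_map_normalizedSum_eq_prod hmeas hindep hL2]
    set c := (√(totalVariance P ξ n))⁻¹ with hc_def
    have hc0 : 0 ≤ c := by positivity
    have hsq : (∑ k ∈ Finset.range n, Var[ξ k; P]) * c ^ 2 = 1 := by
      rw [← totalVariance_eq_sum hindep hL2, hc_def, inv_pow, Real.sq_sqrt hpos.le,
        mul_inv_cancel₀ hpos.ne']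
    have hexp : Complex.exp (t * (0 : ℝ) * Complex.I - ((1 : NNReal) : ℝ) * t ^ 2 / 2)
        = ∏ k ∈ Finset.range n, Complex.exp (-(Var[ξ k; P] * (c * t) ^ 2 / 2 : ℝ)) := by
      rw [← Complex.exp_sum]
      congr 1
      have : ∑ k ∈ Finset.range n, (-(Var[ξ k; P] * (c * t) ^ 2 / 2)) = - (t ^ 2 / 2) := by
        rw [Finset.sum_neg_distrib, ← Finset.sum_div, ← Finset.sum_mul, mul_pow, ← mul_assoc,
          hsq, one_mul]
      have h' := congrArg (fun x : ℝ => (x : ℂ)) this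
      push_cast at h' ⊢
      rw [h']
      ring
    rw [hexp]
    refine (Finset.norm_prod_sub_prod_le (fun k _ => ?_) fun k _ => ?_).trans ?_
    · have : IsProbabilityMeasure (P.map fun ω => ξ k ω - P[ξ k]) :=
        Measure.isProbabilityMeasure_map (by fun_prop)
      exact norm_charFun_le_one _
    · rw [← Complex.ofReal_neg, ← Complex.ofReal_exp, Complex.norm_real, Real.norm_eq_abs,
        Real.abs_exp]
      have := variance_nonneg (ξ k) P
      exact Real.exp_le_one_iff.2 (neg_nonpos.2 (by positivity))
    · refine (Finset.sum_le_sum fun k _ => norm_charFun_sub_exp_le (hmeas k) (hL2 k) (c * t)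
        hu0 (varianceTail_le_iSup hmeas hL2 k u) (hK k)).trans (le_of_eq ?_)
      rw [← Finset.sum_mul, ← hδ_def, abs_mul, abs_of_nonneg hc0]
      calc _ = ((∑ k ∈ Finset.range n, Var[ξ k; P]) * c ^ 2)
            * (4 * |t| ^ 3 * u * c + 4 * t ^ 2 * δ + K * t ^ 4 / 4 * c ^ 2) := by ring
        _ = _ := by rw [hsq, one_mul]

end ShmyrovCLT

theorem theorem1 {Ω : Type*} [MeasurableSpace Ω] (P : Measure Ω) [IsProbabilityMeasure P]
    (ξ : ℕ → Ω → ℝ) (hmeas : ∀ n, Measurable (ξ n)) (hindep : iIndepFun ξ P)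
    (hL2 : ∀ n, MemLp (ξ n) 2 P)
    (hns : ¬ ShmyrovCLT.IsSingular P ξ)
    (hunif : ShmyrovCLT.UniformConvergenceCondition P ξ) :
    TendstoInDistribution (ShmyrovCLT.normalizedSum P ξ) atTop (id : ℝ → ℝ)
        (fun _ => P) (gaussianReal 0 1) ↔
      Tendsto (ShmyrovCLT.totalVariance P ξ) atTop atTop :=
  ⟨ShmyrovCLT.tendsto_totalVariance_atTop hmeas hindep hL2 hns,
    ShmyrovCLT.tendstoInDistribution_normalizedSum hmeas hindep hL2 hunif⟩
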